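/- Let $\eta,r,q\in(2,\infty)$ satisfy $\frac1q+\frac12=\frac1r+\frac1\eta$. There is a constant $C$ depending only on $\eta,r,q$ such that the following holds for every $d\ge 1$. Let $f\in L^{r,\infty}(\mathbb{R}^d)$ and $g\in L^{\eta}(\mathbb{R}^d)$ be real-valued, where $L^{r,\infty}(\mathbb{R}^d)$ is the weak Lebesgue space of measurable functions $f$ with $\|f\|_{L^{r,\infty}}:=\sup_{t>0}t\,|\{|f|>t\}|^{1/r}<\infty$. Then for every $h\in L^2(\mathbb{R}^d)$ the integral $$A_{f,g}h(x)=\int_{\mathbb{R}^d}f(x-y)\,g(y)\,h(y)\,\mathrm{d}y$$ exists as a Lebesgue integral for almost every $x\in\mathbb{R}^d$, and $A_{f,g}$ defines a bounded linear operator from $L^2(\mathbb{R}^d)$ to $L^q(\mathbb{R}^d)$. This operator is $\gamma$-radonifying: for every orthonormal basis $(h_n)_{n\ge1}$ of $L^2(\mathbb{R}^d)$ and every sequence $(\gamma_n)_{n\ge1}$ of independent standard Gaussian random variables on a probability space $\Omega$, the series $\sum_{n\ge1}\gamma_nA_{f,g}h_n$ converges in $L^2(\Omega;L^q(\mathbb{R}^d))$.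 Moreover $$\|A_{f,g}\|_{\gamma(L^2(\mathbb{R}^d),L^q(\mathbb{R}^d))}:=\Big(\mathbb{E}\Big\|\sum_{n\ge1}\gamma_nA_{f,g}h_n\Big\|_{L^q(\mathbb{R}^d)}^2\Big)^{1/2}\le C\,\|f\|_{L^{r,\infty}(\mathbb{R}^d)}\,\|g\|_{L^\eta(\mathbb{R}^d)}.$$ -/

import Mathlib

open MeasureTheory ProbabilityTheory Filter Topology
open scoped ENNReal NNReal

noncomputable section

/-- The weak Lebesgue quasi-norm `‖f‖_{L^{p,∞}(μ)} = sup_{t > 0} t * μ(|f| > t)^{1/p}`. -/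
def weakLpNorm {α : Type*} [MeasurableSpace α] (f : α → ℝ) (p : ℝ) (μ : Measure α) : ℝ≥0∞ :=
  ⨆ (t : ℝ) (_ : 0 < t), ENNReal.ofReal t * (μ {x | t < ‖f x‖}) ^ (1 / p)

/-- Membership in the weak Lebesgue space `L^{p,∞}(μ)`. -/
def MemWeakLp {α : Type*} [MeasurableSpace α] (f : α → ℝ) (p : ℝ) (μ : Measure α) : Prop :=
  AEStronglyMeasurable f μ ∧ weakLpNorm f p μ < ∞

/-- A sequence of independent standard Gaussian random variables. -/
structure IsStdGaussianSeq {Ω : Type*} [MeasurableSpace Ω] (P : Measure Ω)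
    (γ : ℕ → Ω → ℝ) : Prop where
  indep : iIndepFun γ P
  law : ∀ n, HasLaw (γ n) (gaussianReal 0 1) P

section Radonifying

variable {Ω : Type*} [MeasurableSpace Ω]
  {H : Type*} [NormedAddCommGroup H] [InnerProductSpace ℝ H]
  {X : Type*} [NormedAddCommGroup X] [NormedSpace ℝ X]

/-- The series `∑ γ_n T h_n` converges in `L²(Ω; X)` with sum `S`. Here `(h_n)` is an orthonormal
basis of the infinite-dimensional separable Hilbert space `H`. -/
def HasGaussianSum (P : Measure Ω) (γ : ℕ → Ω → ℝ) (h : HilbertBasis ℕ ℝ H) (T : H →L[ℝ] X)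
    (S : Ω → X) : Prop :=
  MemLp S 2 P ∧
    Tendsto (fun N : ℕ => eLpNorm (fun ω => (∑ n ∈ Finset.range N, γ n ω • T (h n)) - S ω) 2 P)
      atTop (𝓝 0)

/-- `T` is `γ`-radonifying: the series `∑ γ_n T h_n` converges in `L²(Ω; X)`. -/
def IsGammaRadonifying (P : Measure Ω) (γ : ℕ → Ω → ℝ) (h : HilbertBasis ℕ ℝ H)
    (T : H →L[ℝ] X) : Prop :=
  ∃ S : Ω → X, HasGaussianSum P γ h T S

open Classical in
/-- The norm `‖T‖_{γ(H,X)} = (𝔼 ‖∑ γ_n T h_n‖²)^{1/2}`, and `∞` if `T` is not `γ`-radonifying.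
The `L²(Ω; X)`-sum is unique up to almost sure equality, so the choice of `S` is immaterial. -/
def gammaNorm (P : Measure Ω) (γ : ℕ → Ω → ℝ) (h : HilbertBasis ℕ ℝ H)
    (T : H →L[ℝ] X) : ℝ≥0∞ :=
  if hT : IsGammaRadonifying P γ h T then eLpNorm hT.choose 2 P else ∞

end Radonifying

/-- `A_{f,g} u (x) = ∫ f(x - y) g(y) u(y) dy`, wherever the integral exists. -/
def convMulOp {d : ℕ} (f g u : EuclideanSpace ℝ (Fin d) → ℝ) (x : EuclideanSpace ℝ (Fin d)) : ℝ :=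
  ∫ y, f (x - y) * g y * u y

/-- The bounded operator `T : L²(ℝ^d) → L^p(ℝ^d)` is the operator `A_{f,g}`: for every
`u ∈ L²(ℝ^d)` the integral `A_{f,g} u (x)` exists as a Lebesgue integral for almost all `x`, and
`T u` is the class of `A_{f,g} u`. -/
def IsConvMulOp {d : ℕ} {p : ℝ≥0∞} [Fact (1 ≤ p)] (f g : EuclideanSpace ℝ (Fin d) → ℝ)
    (T : Lp ℝ 2 (volume : Measure (EuclideanSpace ℝ (Fin d))) →L[ℝ]
      Lp ℝ p (volume : Measure (EuclideanSpace ℝ (Fin d)))) : Prop :=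
  ∀ u : Lp ℝ 2 (volume : Measure (EuclideanSpace ℝ (Fin d))),
    (∀ᵐ x, Integrable (fun y => f (x - y) * g y * u y)) ∧ T u =ᵐ[volume] convMulOp f g u

end

/-! For almost every x the value A_{f,g}u(x) is the inner product of u with ψ(x) = f(x - ·)g in L²,
and ‖ψ(x)‖ = k(x), where k² = |f|² * |g|². By Bessel, the square function (∑ |A h_n(x)|²)^{1/2} is
at most k(x), whatever the basis.

At fixed x a Gaussian sum is a centred Gaussian whose variance is the sum of squared coefficients,
so its q-th moment is a constant times a power of the square function. As q > 2, the L²(Ω) norm is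
at most the L^q(Ω) norm, and Fubini in L^q(Ω × ℝ^d) reduces everything to k ∈ L^q. Tails of the
series are controlled in the same way, with dominated convergence giving the Cauchy property
(`isGammaRadonifying_of_inner_eq`, `gammaNorm_le_of_inner_eq`).

That k ∈ L^q is the weak Young inequality for |f|² ∈ L^{r/2,∞} and |g|² ∈ L^{η/2} with target
L^{q/2} (`lintegral_rpow_lintegral_mul_le_of_weak`). By duality it is a trilinear estimate, split
according to which of H^s and G^b is larger. The smaller function is then bounded pointwise by the
larger, and a dyadic decomposition of the kernel around a well-chosen level gives two convergent
geometric series (`lintegral_mul_le_of_weak_of_bounded`). Only distribution functions of translates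
enter, so the constant does not see the dimension. -/

noncomputable section

/-! ### Weak Young inequality for kernels -/

section WeakSchur

/-- The sum of the dyadic series occurring in the truncation estimate for weak `L^a`. -/
def dyadicConst (a s : ℝ) : ℝ≥0∞ :=
  2 * ∑' k : ℕ, ((2 : ℝ≥0∞) ^ (1 - a)) ^ k +
    (2 : ℝ≥0∞) ^ (a * (1 - 1 / s)) * ∑' k : ℕ, ((2 : ℝ≥0∞) ^ (a * (1 - 1 / s) - 1)) ^ k

lemma ENNReal.tsum_two_rpow_neg_ne_top {e : ℝ} (he : e < 0) :
    ∑' k : ℕ, ((2 : ℝ≥0∞) ^ e) ^ k ≠ ∞ := by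
  rw [ENNReal.tsum_geometric]
  refine ENNReal.inv_ne_top.2 (tsub_pos_of_lt ?_).ne'
  exact ENNReal.rpow_lt_one_of_one_lt_of_neg (by norm_num) he

/-- The two ratios are below 1 precisely because a > 1 (levels going up) and 1/a + 1/s > 1 (levels
going down). -/
lemma dyadicConst_ne_top {a s : ℝ} (ha : 1 < a) (has : 1 < 1 / a + 1 / s) :
    dyadicConst a s ≠ ∞ := by
  have h1 : a * (1 - 1 / s) - 1 < 0 := by
    have : a * (1 - 1 / s) < a * (1 / a) := by
      apply mul_lt_mul_of_pos_left _ (by linarith)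
      linarith
    rw [mul_one_div_cancel (by linarith)] at this
    linarith
  refine ENNReal.add_ne_top.2 ⟨ENNReal.mul_ne_top (by norm_num) ?_, ENNReal.mul_ne_top ?_ ?_⟩
  · exact ENNReal.tsum_two_rpow_neg_ne_top (by linarith)
  · exact ENNReal.rpow_ne_top_of_ne_zero (by norm_num) (by norm_num)
  · exact ENNReal.tsum_two_rpow_neg_ne_top h1

lemma dyadicConst_ne_zero {a s : ℝ} : dyadicConst a s ≠ 0 := by
  have : (2 : ℝ≥0∞) * 1 ≤ dyadicConst a s := by
    refine le_trans ?_ le_self_add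
    gcongr
    exact (pow_zero _).symm.le.trans (ENNReal.le_tsum (f := fun k => ((2 : ℝ≥0∞) ^ (1 - a)) ^ k) 0)
  intro h
  simp [h] at this

/-- If l·2^n < F ≤ l·2^(n+1), one term alone dominates F: the term k = n of the first sum when n ≥
0, the term k = -n - 1 of the second when n < 0. -/
lemma le_dyadic_sum {l F : ℝ≥0∞} (hl : l ≠ 0) (hl' : l ≠ ∞) (hF : F ≠ ∞) :
    F ≤ ∑' k : ℕ, (if l * 2 ^ (k : ℝ) < F then l * 2 ^ ((k : ℝ) + 1) else 0) +
      ∑' k : ℕ, (if l * 2 ^ (-(k : ℝ) - 1) < F then l * 2 ^ (-(k : ℝ)) else 0) := by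
  rcases eq_or_ne F 0 with rfl | hF0
  · simp
  obtain ⟨n, hn1, hn2⟩ := ENNReal.exists_mem_Ioc_zpow (x := F / l) (y := 2)
    (by simp [hF0, hl']) (ENNReal.div_ne_top hF hl) (by norm_num) (by norm_num)
  have e (m : ℤ) : (2 : ℝ≥0∞) ^ m = 2 ^ (m : ℝ) := (ENNReal.rpow_intCast _ _).symm
  rw [e, ENNReal.lt_div_iff_mul_lt (Or.inl hl) (Or.inl hl'), mul_comm] at hn1
  rw [e, ENNReal.div_le_iff_le_mul (Or.inl hl) (Or.inl hl'), mul_comm] at hn2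
  rcases le_or_gt 0 n with h | h
  · lift n to ℕ using h
    refine le_trans ?_ le_self_add
    refine le_trans ?_ (ENNReal.le_tsum n)
    push_cast at hn1 hn2
    rw [if_pos hn1]
    exact hn2
  · obtain ⟨m, rfl⟩ : ∃ m : ℕ, n = -(m : ℤ) - 1 := ⟨(-n - 1).toNat, by omega⟩
    refine le_trans ?_ le_add_self
    refine le_trans ?_ (ENNReal.le_tsum m)
    push_cast at hn1 hn2
    rw [if_pos hn1]
    simpa using hn2

variable {X Y : Type*} [MeasurableSpace X] [MeasurableSpace Y]

/-- Hölder on E against the constant 1. -/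
lemma setLIntegral_le_of_lintegral_rpow_le_one {μ : Measure X} {h : X → ℝ≥0∞} {s : ℝ}
    (hs : 1 < s) (hh : Measurable h) (hh1 : ∫⁻ x, h x ^ s ∂μ ≤ 1) (E : Set X) :
    ∫⁻ x in E, h x ∂μ ≤ μ E ^ (1 - 1 / s) := by
  have hc : s.HolderConjugate (s.conjExponent) := Real.HolderConjugate.conjExponent hs
  have := ENNReal.lintegral_mul_le_Lp_mul_Lq (μ.restrict E) hc hh.aemeasurable
    (g := fun _ => 1) aemeasurable_const
  simp only [Pi.mul_apply, mul_one, ENNReal.one_rpow, lintegral_const, one_mul,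
    Measure.restrict_apply_univ] at this
  refine this.trans ?_
  have h2 : 1 / s.conjExponent = 1 - 1 / s := by
    have := hc.inv_add_inv_eq_one
    simp only [one_div]; linarith
  rw [h2]
  refine mul_le_of_le_one_left' ?_
  exact ENNReal.rpow_le_one ((setLIntegral_le_lintegral _ _).trans hh1) (by positivity)

/-- If `F` is in weak `L^a`, and `h ∈ L^s` is bounded, then `F h` is integrable when
`1 < 1 / a + 1 / s`. -/
lemma lintegral_mul_le_of_weak_of_bounded {μ : Measure X} {F h : X → ℝ≥0∞} {a s : ℝ}
    (ha : 1 < a) (hs : 1 < s) (has : 1 < 1 / a + 1 / s) (hF : Measurable F) (hh : Measurable h)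
    (hFtop : ∀ x, F x ≠ ∞)
    (hFa : ∀ t : ℝ≥0∞, t ≠ 0 → t ≠ ∞ → μ {x | t < F x} ≤ t ^ (-a))
    (hh1 : ∫⁻ x, h x ^ s ∂μ ≤ 1) {l : ℝ≥0∞} (hl : ∀ x, h x ≤ l ^ (a / s)) :
    ∫⁻ x, F x * h x ∂μ ≤ dyadicConst a s * l ^ (1 + a / s - a) := by
  have hexp : 0 < 1 + a / s - a := by
    have : a * 1 < a * (1 / a + 1 / s) := mul_lt_mul_of_pos_left has (by linarith)
    rw [mul_add, mul_one_div_cancel (by linarith), mul_one_div] at this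
    linarith
  rcases eq_or_ne l 0 with rfl | hl0
  · have : ∀ x, h x = 0 := fun x => by
      have := hl x
      rwa [ENNReal.zero_rpow_of_pos (by positivity), nonpos_iff_eq_zero] at this
    simp [this]
  rcases eq_or_ne l ∞ with rfl | hltop
  -- The exponent is positive and the constant nonzero, so the right side is infinite.
  · rw [ENNReal.top_rpow_of_pos hexp, ENNReal.mul_top dyadicConst_ne_zero]
    exact le_top
  have h2 (e : ℝ) : (2 : ℝ≥0∞) ^ e ≠ 0 ∧ (2 : ℝ≥0∞) ^ e ≠ ∞ :=
    ⟨(ENNReal.rpow_pos (by norm_num) (by norm_num)).ne',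
      ENNReal.rpow_ne_top_of_ne_zero (by norm_num) (by norm_num)⟩
  have hm (t : ℝ≥0∞) : MeasurableSet {x | t < F x} := measurableSet_lt measurable_const hF
  have hind (t c : ℝ≥0∞) : ∫⁻ x, (if t < F x then c else 0) * h x ∂μ
      = c * ∫⁻ x in {x | t < F x}, h x ∂μ := by
    rw [← lintegral_const_mul _ hh, ← lintegral_indicator (hm t)]
    refine lintegral_congr fun x => ?_
    by_cases hx : t < F x <;> simp [hx]
  have hmeas (t c : ℝ≥0∞) : Measurable fun x => (if t < F x then c else 0) * h x :=
    (Measurable.ite (hm t) measurable_const measurable_const).mul hh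
  calc ∫⁻ x, F x * h x ∂μ
      ≤ ∫⁻ x, (∑' k : ℕ, (if l * 2 ^ (k : ℝ) < F x then l * 2 ^ ((k : ℝ) + 1) else 0) * h x +
        ∑' k : ℕ, (if l * 2 ^ (-(k : ℝ) - 1) < F x then l * 2 ^ (-(k : ℝ)) else 0) * h x) ∂μ := by
        refine lintegral_mono fun x => ?_
        rw [ENNReal.tsum_mul_right, ENNReal.tsum_mul_right, ← add_mul]
        exact mul_le_mul_left (le_dyadic_sum hl0 hltop (hFtop x)) _
    _ = ∑' k : ℕ, l * 2 ^ ((k : ℝ) + 1) * ∫⁻ x in {x | l * 2 ^ (k : ℝ) < F x}, h x ∂μ +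
        ∑' k : ℕ, l * 2 ^ (-(k : ℝ)) * ∫⁻ x in {x | l * 2 ^ (-(k : ℝ) - 1) < F x}, h x ∂μ := by
        rw [lintegral_add_left (Measurable.tsum fun k => hmeas _ _),
          lintegral_tsum fun k => (hmeas _ _).aemeasurable,
          lintegral_tsum fun k => (hmeas _ _).aemeasurable]
        simp_rw [hind]
    _ ≤ ∑' k : ℕ, 2 * l ^ (1 + a / s - a) * ((2 : ℝ≥0∞) ^ (1 - a)) ^ k +
        ∑' k : ℕ, (2 : ℝ≥0∞) ^ (a * (1 - 1 / s)) * l ^ (1 + a / s - a) *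
          ((2 : ℝ≥0∞) ^ (a * (1 - 1 / s) - 1)) ^ k := by
        refine add_le_add (ENNReal.tsum_le_tsum fun k => ?_) (ENNReal.tsum_le_tsum fun k => ?_)
        -- Levels above l: the sup bound on h and the weak bound on the level set give ratio 2^(1 -
        -- a).
        · calc l * 2 ^ ((k : ℝ) + 1) * ∫⁻ x in {x | l * 2 ^ (k : ℝ) < F x}, h x ∂μ
              ≤ l * 2 ^ ((k : ℝ) + 1) * (l ^ (a / s) * (l * 2 ^ (k : ℝ)) ^ (-a)) := by
                gcongr
                refine (lintegral_mono hl).trans ?_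
                rw [lintegral_const, Measure.restrict_apply_univ]
                gcongr
                exact hFa _ (mul_ne_zero hl0 (h2 _).1) (ENNReal.mul_ne_top hltop (h2 _).2)
            _ = (l ^ (1 : ℝ) * l ^ (a / s) * l ^ (-a)) *
                (2 ^ ((k : ℝ) + 1) * 2 ^ ((k : ℝ) * (-a))) := by
                rw [ENNReal.mul_rpow_of_ne_top hltop (h2 _).2, ← ENNReal.rpow_mul,
                  ENNReal.rpow_one]
                ring
            _ = l ^ (1 + a / s - a) * (2 ^ (1 : ℝ) * 2 ^ ((1 - a) * (k : ℝ))) := by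
                rw [← ENNReal.rpow_add _ _ hl0 hltop, ← ENNReal.rpow_add _ _ hl0 hltop,
                  ← ENNReal.rpow_add _ _ (by norm_num) (by norm_num),
                  ← ENNReal.rpow_add _ _ (by norm_num) (by norm_num)]
                congr 2
                ring
            _ = _ := by
                rw [ENNReal.rpow_mul, ENNReal.rpow_natCast, ENNReal.rpow_one]
                ring
        -- Levels below l: the sup bound would diverge, so the L^s bound on h is used through Hölder
        -- on the level set.
        · calc l * 2 ^ (-(k : ℝ)) * ∫⁻ x in {x | l * 2 ^ (-(k : ℝ) - 1) < F x}, h x ∂μ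
              ≤ l * 2 ^ (-(k : ℝ)) * ((l * 2 ^ (-(k : ℝ) - 1)) ^ (-a)) ^ (1 - 1 / s) := by
                gcongr
                refine (setLIntegral_le_of_lintegral_rpow_le_one hs hh hh1 _).trans ?_
                have : 0 ≤ 1 - 1 / s := by
                  rw [sub_nonneg, div_le_one (by linarith)]; exact hs.le
                gcongr
                exact hFa _ (mul_ne_zero hl0 (h2 _).1) (ENNReal.mul_ne_top hltop (h2 _).2)
            _ = (l ^ (1 : ℝ) * l ^ (-a * (1 - 1 / s))) *
                (2 ^ (-(k : ℝ)) * 2 ^ ((-(k : ℝ) - 1) * (-a * (1 - 1 / s)))) := by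
                rw [← ENNReal.rpow_mul, ENNReal.mul_rpow_of_ne_top hltop (h2 _).2,
                  ← ENNReal.rpow_mul, ENNReal.rpow_one]
                ring
            _ = l ^ (1 + a / s - a) * (2 ^ (a * (1 - 1 / s)) *
                2 ^ ((a * (1 - 1 / s) - 1) * (k : ℝ))) := by
                rw [← ENNReal.rpow_add _ _ hl0 hltop,
                  ← ENNReal.rpow_add _ _ (by norm_num) (by norm_num),
                  ← ENNReal.rpow_add _ _ (by norm_num) (by norm_num)]
                congr 2 <;> ring
            _ = _ := by
                rw [ENNReal.rpow_mul 2 _ (k : ℝ), ENNReal.rpow_natCast]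
                ring
    _ = _ := by
        rw [ENNReal.tsum_mul_left, ENNReal.tsum_mul_left, dyadicConst]
        ring

/-- One half of the trilinear weak Young inequality. -/
lemma lintegral_lintegral_mul_le_of_weak_of_le {μ : Measure X} {ν : Measure Y}
    {Φ : X → Y → ℝ≥0∞} {G : Y → ℝ≥0∞} {H : X → ℝ≥0∞} {a b s : ℝ}
    (ha : 1 < a) (hb : 1 < b) (hs : 1 < s) (habs : 1 / a + 1 / b + 1 / s = 2)
    (hΦ : Measurable (Function.uncurry Φ)) (hG : Measurable G) (hH : Measurable H)
    (hΦtop : ∀ x y, Φ x y ≠ ∞)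
    (hΦa : ∀ y, ∀ t : ℝ≥0∞, t ≠ 0 → t ≠ ∞ → μ {x | t < Φ x y} ≤ t ^ (-a))
    (hG1 : ∫⁻ y, G y ^ b ∂ν ≤ 1) (hH1 : ∫⁻ x, H x ^ s ∂μ ≤ 1) :
    ∫⁻ y, G y * ∫⁻ x, Φ x y * (if H x ^ s ≤ G y ^ b then H x else 0) ∂μ ∂ν ≤ dyadicConst a s := by
  have has : 1 < 1 / a + 1 / s := by
    have : 1 / b < 1 := by rw [div_lt_one (by linarith)]; exact hb
    linarith
  have hexp : 0 < 1 + a / s - a := by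
    have : a * 1 < a * (1 / a + 1 / s) := mul_lt_mul_of_pos_left has (by linarith)
    rw [mul_add, mul_one_div_cancel (by linarith), mul_one_div] at this
    linarith
  -- The scaling relation between a, b and s makes the final power of G y exactly b, which is
  -- integrable.
  have hbe : 1 + b / a * (1 + a / s - a) = b := by
    have : 1 / a = 2 - 1 / b - 1 / s := by linarith
    have h1 : b / a * (1 + a / s - a) = b * (1 / a) + b / s - b := by field_simp
    rw [h1, this]
    field_simp
    ring
  calc ∫⁻ y, G y * ∫⁻ x, Φ x y * (if H x ^ s ≤ G y ^ b then H x else 0) ∂μ ∂ν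
      ≤ ∫⁻ y, dyadicConst a s * G y ^ b ∂ν := by
        refine lintegral_mono fun y => ?_
        -- The level l = G^(b/a) is chosen so that l^(a/s) = G^(b/s), the bound on H imposed by the
        -- truncation H^s ≤ G^b.
        have key := lintegral_mul_le_of_weak_of_bounded (μ := μ) (F := fun x => Φ x y)
          (h := fun x => if H x ^ s ≤ G y ^ b then H x else 0) (l := G y ^ (b / a)) ha hs has
          (hΦ.comp measurable_prodMk_right)
          (Measurable.ite (measurableSet_le (hH.pow_const _) measurable_const) hH
            measurable_const) (fun x => hΦtop x y) (hΦa y)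
          (by
            refine le_trans (lintegral_mono fun x => ?_) hH1
            split_ifs
            · exact le_rfl
            · rw [ENNReal.zero_rpow_of_pos (by linarith)]; exact zero_le)
          (by
            intro x
            split_ifs with hx
            · rw [← ENNReal.rpow_mul, div_mul_div_cancel₀ (by linarith), div_eq_mul_inv,
                ENNReal.rpow_mul]
              rwa [ENNReal.le_rpow_inv_iff (by linarith)]
            · exact zero_le)
        refine (mul_le_mul_right key _).trans_eq ?_
        rw [← ENNReal.rpow_mul, mul_left_comm]
        congr 1
        nth_rw 1 [← ENNReal.rpow_one (G y)]
        rw [← ENNReal.rpow_add_of_nonneg _ _ zero_le_one (by positivity), hbe]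
    _ ≤ dyadicConst a s := by
        rw [lintegral_const_mul _ (hG.pow_const _)]
        exact mul_le_of_le_one_right' hG1

/-- Trilinear form of the weak Young inequality, for kernels. -/
lemma lintegral_mul_lintegral_mul_le_of_weak {μ : Measure X} {ν : Measure Y}
    [SFinite μ] [SFinite ν]
    {Φ : X → Y → ℝ≥0∞} {G : Y → ℝ≥0∞} {H : X → ℝ≥0∞} {a b s : ℝ}
    (ha : 1 < a) (hb : 1 < b) (hs : 1 < s) (habs : 1 / a + 1 / b + 1 / s = 2)
    (hΦ : Measurable (Function.uncurry Φ)) (hG : Measurable G) (hH : Measurable H)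
    (hΦtop : ∀ x y, Φ x y ≠ ∞)
    (hΦa : ∀ y, ∀ t : ℝ≥0∞, t ≠ 0 → t ≠ ∞ → μ {x | t < Φ x y} ≤ t ^ (-a))
    (hΦa' : ∀ x, ∀ t : ℝ≥0∞, t ≠ 0 → t ≠ ∞ → ν {y | t < Φ x y} ≤ t ^ (-a))
    (hG1 : ∫⁻ y, G y ^ b ∂ν ≤ 1) (hH1 : ∫⁻ x, H x ^ s ∂μ ≤ 1) :
    ∫⁻ x, H x * ∫⁻ y, Φ x y * G y ∂ν ∂μ ≤ dyadicConst a s + dyadicConst a b := by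
  have hΦx (x : X) : Measurable fun y => Φ x y := hΦ.comp measurable_prodMk_left
  have hΦy (y : Y) : Measurable fun x => Φ x y := hΦ.comp measurable_prodMk_right
  have hite1 : MeasurableSet {p : X × Y | H p.1 ^ s ≤ G p.2 ^ b} :=
    measurableSet_le ((hH.comp measurable_fst).pow_const _) ((hG.comp measurable_snd).pow_const _)
  have hm1 : Measurable (Function.uncurry fun (x : X) (y : Y) =>
      G y * (Φ x y * if H x ^ s ≤ G y ^ b then H x else 0)) :=
    (hG.comp measurable_snd).mul
      (hΦ.mul (Measurable.ite hite1 (hH.comp measurable_fst) measurable_const))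
  have hsplit : ∀ x, H x * ∫⁻ y, Φ x y * G y ∂ν ≤
      ∫⁻ y, G y * (Φ x y * if H x ^ s ≤ G y ^ b then H x else 0) ∂ν +
      H x * ∫⁻ y, Φ x y * (if G y ^ b ≤ H x ^ s then G y else 0) ∂ν := by
    intro x
    have hm2 : Measurable fun y => Φ x y * (if G y ^ b ≤ H x ^ s then G y else 0) :=
      (hΦx x).mul (Measurable.ite (measurableSet_le (hG.pow_const _) measurable_const) hG
        measurable_const)
    rw [← lintegral_const_mul (f := fun y => Φ x y * G y) _ ((hΦx x).mul hG),
      ← lintegral_const_mul _ hm2,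
      ← lintegral_add_left (f := fun y => G y * (Φ x y * if H x ^ s ≤ G y ^ b then H x else 0))
        (hm1.comp measurable_prodMk_left)]
    refine lintegral_mono fun y => ?_
    dsimp only
    rcases le_total (H x ^ s) (G y ^ b) with h | h
    · rw [if_pos h]
      refine le_trans (le_of_eq ?_) le_self_add
      ring
    · rw [if_pos h]
      exact le_add_self
  refine (lintegral_mono hsplit).trans ?_
  rw [lintegral_add_left (show Measurable fun x =>
    ∫⁻ y, G y * (Φ x y * if H x ^ s ≤ G y ^ b then H x else 0) ∂ν from hm1.lintegral_prod_right')]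
  refine add_le_add ?_ ?_
  · rw [lintegral_lintegral_swap hm1.aemeasurable]
    refine le_of_eq_of_le (lintegral_congr fun y => ?_) (lintegral_lintegral_mul_le_of_weak_of_le
      (μ := μ) (ν := ν) ha hb hs habs hΦ hG hH hΦtop hΦa hG1 hH1)
    rw [lintegral_const_mul]
    exact (hΦy y).mul (Measurable.ite (measurableSet_le (hH.pow_const _) measurable_const) hH
        measurable_const)
  -- The other region is the same estimate for the transposed kernel, with (G, b) and (H, s)
  -- exchanged.
  · exact lintegral_lintegral_mul_le_of_weak_of_le (μ := ν) (ν := μ) (Φ := fun y x => Φ x y)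
      ha hs hb (by linarith) (hΦ.comp measurable_swap) hH hG (fun y x => hΦtop x y) hΦa' hH1 hG1

/-- The weak Young inequality for kernels. -/
theorem lintegral_rpow_lintegral_mul_le_of_weak {μ : Measure X} {ν : Measure Y}
    [SigmaFinite μ] [SFinite ν]
    {Φ : X → Y → ℝ≥0∞} {G : Y → ℝ≥0∞} {a b c : ℝ}
    (ha : 1 < a) (hb : 1 < b) (hc : 1 < c) (habc : 1 / a + 1 / b = 1 + 1 / c)
    (hΦ : Measurable (Function.uncurry Φ)) (hG : Measurable G)
    (hΦtop : ∀ x y, Φ x y ≠ ∞)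
    (hΦa : ∀ y, ∀ t : ℝ≥0∞, t ≠ 0 → t ≠ ∞ → μ {x | t < Φ x y} ≤ t ^ (-a))
    (hΦa' : ∀ x, ∀ t : ℝ≥0∞, t ≠ 0 → t ≠ ∞ → ν {y | t < Φ x y} ≤ t ^ (-a))
    (hG1 : ∫⁻ y, G y ^ b ∂ν ≤ 1) :
    (∫⁻ x, (∫⁻ y, Φ x y * G y ∂ν) ^ c ∂μ) ^ (1 / c) ≤
      dyadicConst a (c / (c - 1)) + dyadicConst a b := by
  set D := dyadicConst a (c / (c - 1)) + dyadicConst a b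
  set s := c / (c - 1) with hs_def
  have hs : 1 < s := by rw [hs_def, one_lt_div (by linarith)]; linarith
  have hsc : 1 / s = 1 - 1 / c := by
    rw [hs_def, one_div_div, sub_div, div_self (by linarith)]
  set K : X → ℝ≥0∞ := fun x => ∫⁻ y, Φ x y * G y ∂ν
  have hK : Measurable K := (hΦ.mul (hG.comp measurable_snd)).lintegral_prod_right'
  -- Truncating K in height and support makes the norm finite, so that it can be divided out in the
  -- duality argument; monotone convergence removes the truncation.
  let H : ℕ → X → ℝ≥0∞ := fun n => (spanningSets μ n).indicator fun x => min (K x) n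
  have hHm (n : ℕ) : Measurable (H n) :=
    (hK.min measurable_const).indicator (measurableSet_spanningSets μ n)
  have hHK (n : ℕ) (x : X) : H n x ≤ K x :=
    (Set.indicator_le_self _ _ x).trans (min_le_left _ _)
  have hbound (n : ℕ) : (∫⁻ x, H n x ^ c ∂μ) ^ (1 / c) ≤ D := by
    set N := ∫⁻ x, H n x ^ c ∂μ
    rcases eq_or_ne N 0 with hN0 | hN0
    · rw [hN0, ENNReal.zero_rpow_of_pos (by positivity)]; exact zero_le
    have hNtop : N ≠ ∞ := by
      have : N ≤ ∫⁻ x in spanningSets μ n, (n : ℝ≥0∞) ^ c ∂μ := by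
        rw [← lintegral_indicator (measurableSet_spanningSets μ n)]
        refine lintegral_mono fun x => ?_
        by_cases hx : x ∈ spanningSets μ n
        · simp only [H, hx, Set.indicator_of_mem]
          gcongr
          exact min_le_right _ _
        · simp [H, hx, show 0 < c by linarith]
      refine ne_top_of_le_ne_top ?_ this
      rw [lintegral_const, Measure.restrict_apply_univ]
      refine ENNReal.mul_ne_top ?_ (measure_spanningSets_lt_top μ n).ne
      exact ENNReal.rpow_ne_top_of_nonneg (by linarith) (ENNReal.natCast_ne_top n)
    have hNs0 : N ^ (1 / s) ≠ 0 := (ENNReal.rpow_pos (pos_iff_ne_zero.2 hN0) hNtop).ne'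
    have hNst : N ^ (1 / s) ≠ ∞ := ENNReal.rpow_ne_top_of_nonneg (by positivity) hNtop
    -- The extremal test function of L^c–L^s duality: since (c - 1)s = c, its L^s norm is 1.
    have key := lintegral_mul_lintegral_mul_le_of_weak (μ := μ) (ν := ν)
      (H := fun x => (N ^ (1 / s))⁻¹ * H n x ^ (c - 1)) ha hb hs
      (by rw [hsc]; linarith) hΦ hG ((hHm n).pow_const _ |>.const_mul _) hΦtop hΦa hΦa' hG1
      (by
        have e : ∀ x, ((N ^ (1 / s))⁻¹ * H n x ^ (c - 1)) ^ s = N⁻¹ * H n x ^ c := by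
          intro x
          rw [ENNReal.mul_rpow_of_nonneg _ _ (by linarith), ← ENNReal.rpow_mul, ENNReal.inv_rpow,
            ← ENNReal.rpow_mul, one_div_mul_cancel (by linarith), ENNReal.rpow_one, hs_def,
            mul_div_cancel₀ _ (by linarith : c - 1 ≠ 0)]
        simp_rw [e]
        rw [lintegral_const_mul _ ((hHm n).pow_const _)]
        exact (ENNReal.inv_mul_cancel hN0 hNtop).le)
    have hle : (N ^ (1 / s))⁻¹ * N ≤ D := by
      refine le_trans ?_ key
      rw [← lintegral_const_mul _ ((hHm n).pow_const _)]
      refine lintegral_mono fun x => ?_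
      rw [mul_assoc]
      gcongr
      -- Only one factor of the truncation is enlarged to K; the others stay in the test function.
      calc H n x ^ c = H n x ^ (c - 1) * H n x ^ (1 : ℝ) := by
            rw [← ENNReal.rpow_add_of_nonneg _ _ (by linarith) zero_le_one, sub_add_cancel]
        _ ≤ _ := by rw [ENNReal.rpow_one]; gcongr; exact hHK n x
    refine le_of_eq_of_le ?_ hle
    rw [← ENNReal.rpow_neg]
    nth_rw 3 [← ENNReal.rpow_one N]
    rw [← ENNReal.rpow_add _ _ hN0 hNtop, hsc]
    congr 1
    ring
  have hmono (x : X) : Monotone fun n => H n x := by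
    intro m n hmn
    refine (Set.indicator_le_indicator_of_subset (monotone_spanningSets μ hmn)
      (fun _ => zero_le) x).trans ?_
    refine Set.indicator_le_indicator ?_
    gcongr
  have hsup (x : X) : ⨆ n, H n x = K x := by
    refine le_antisymm (iSup_le fun n => hHK n x) ?_
    refine le_of_forall_lt fun t ht => ?_
    obtain ⟨m, hm⟩ := ENNReal.exists_nat_gt ht.ne_top
    obtain ⟨n, hn⟩ : ∃ n, x ∈ spanningSets μ n := by
      have := iUnion_spanningSets μ
      exact Set.mem_iUnion.1 (this ▸ Set.mem_univ x)
    refine lt_of_lt_of_le ?_ (le_iSup _ (max m n))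
    simp only [H]
    rw [Set.indicator_of_mem (monotone_spanningSets μ (le_max_right m n) hn)]
    refine lt_min ht (hm.trans_le ?_)
    exact_mod_cast le_max_left m n
  have hc0 : 0 < c := by linarith
  have hlim : ∫⁻ x, K x ^ c ∂μ = ⨆ n, ∫⁻ x, H n x ^ c ∂μ := by
    rw [← lintegral_iSup (fun n => (hHm n).pow_const _)
      (fun m n hmn x => ENNReal.rpow_le_rpow (hmono x hmn) hc0.le)]
    refine lintegral_congr fun x => ?_
    rw [← hsup x]
    exact (ENNReal.orderIsoRpow c hc0).map_iSup _
  rw [hlim, one_div, ENNReal.rpow_inv_le_iff hc0]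
  refine iSup_le fun n => ?_
  rw [← ENNReal.rpow_inv_le_iff hc0, ← one_div]
  exact hbound n

end WeakSchur

/-! ### Gaussian sums in L^q and square functions -/

section GaussianSums

/-- The absolute moment of order `q` of a standard Gaussian variable. -/
def gaussianMoment (q : ℝ) : ℝ≥0∞ := ∫⁻ z, ‖z‖ₑ ^ q ∂gaussianReal 0 1

lemma gaussianMoment_ne_top {q : ℝ} (hq : 0 < q) : gaussianMoment q ≠ ∞ := by
  have h := (memLp_id_gaussianReal' (μ := 0) (v := 1) (ENNReal.ofReal q) ENNReal.ofReal_ne_top).2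
  rw [eLpNorm_lt_top_iff_lintegral_rpow_enorm_lt_top (by simpa using hq) ENNReal.ofReal_ne_top,
    ENNReal.toReal_ofReal hq.le] at h
  exact h.ne

variable {Ω : Type*} [MeasurableSpace Ω] {P : Measure Ω} {γ : ℕ → Ω → ℝ}

lemma IsStdGaussianSeq.hasLaw_sum_mul [IsProbabilityMeasure P] (hγ : IsStdGaussianSeq P γ)
    (c : ℕ → ℝ) (s : Finset ℕ) :
    HasLaw (∑ n ∈ s, fun ω => c n * γ n ω) (gaussianReal 0 (∑ n ∈ s, ‖c n‖₊ ^ 2)) P := by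
  have hlaw (n : ℕ) : HasLaw (fun ω => c n * γ n ω) (gaussianReal 0 (‖c n‖₊ ^ 2)) P := by
    have := gaussianReal_const_mul (hγ.law n) (c n)
    have e : NNReal.mk (c n ^ 2) (sq_nonneg _) * 1 = ‖c n‖₊ ^ 2 := by
      ext; simp
    rwa [mul_zero, e] at this
  have hind : iIndepFun (fun n ω => c n * γ n ω) P :=
    hγ.indep.comp (fun n z => c n * z) fun n => measurable_const_mul _
  induction s using Finset.induction_on with
  | empty =>
    refine ⟨aemeasurable_const, ?_⟩
    simp only [Finset.sum_empty, gaussianReal_zero_var]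
    change P.map (fun _ => (0 : ℝ)) = _
    rw [Measure.map_const, measure_univ, one_smul]
  | insert i s hi ih =>
    rw [Finset.sum_insert hi, Finset.sum_insert hi]
    have hi' := (hind.indepFun_finsetSum_of_notMem₀ (fun n => (hlaw n).aemeasurable) hi).symm
    refine ⟨(hlaw i).aemeasurable.add ih.aemeasurable, ?_⟩
    have := gaussianReal_add_gaussianReal_of_indepFun hi' (hlaw i).map_eq ih.map_eq
    rwa [add_zero] at this

/-- The sum has the law of √v times a standard Gaussian, where v is the sum of the squared
coefficients, so v^(q/2) factors out of the moment. -/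
lemma IsStdGaussianSeq.lintegral_enorm_sum_rpow [IsProbabilityMeasure P]
    (hγ : IsStdGaussianSeq P γ) (c : ℕ → ℝ) (s : Finset ℕ) {q : ℝ} (hq : 0 < q) :
    ∫⁻ ω, ‖∑ n ∈ s, γ n ω * c n‖ₑ ^ q ∂P =
      gaussianMoment q * (∑ n ∈ s, ‖c n‖ₑ ^ 2) ^ (q / 2) := by
  set v : ℝ≥0 := ∑ n ∈ s, ‖c n‖₊ ^ 2 with hv
  have hv' : ∑ n ∈ s, ‖c n‖ₑ ^ 2 = (v : ℝ≥0∞) := by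
    rw [hv]; push_cast; rfl
  have hmeas : Measurable fun z : ℝ => ‖z‖ₑ ^ q := measurable_enorm.pow_const _
  have hmap : (gaussianReal 0 1).map (fun z => (NNReal.sqrt v : ℝ) * z) = gaussianReal 0 v := by
    rw [gaussianReal_map_const_mul, mul_zero]
    congr 1
    ext
    simp
  calc ∫⁻ ω, ‖∑ n ∈ s, γ n ω * c n‖ₑ ^ q ∂P
      = ∫⁻ ω, ‖(∑ n ∈ s, fun ω => c n * γ n ω) ω‖ₑ ^ q ∂P := by
        refine lintegral_congr fun ω => ?_
        rw [Finset.sum_apply]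
        simp_rw [mul_comm]
    _ = ∫⁻ z, ‖z‖ₑ ^ q ∂gaussianReal 0 v :=
        (hγ.hasLaw_sum_mul c s).lintegral_comp hmeas.aemeasurable
    _ = ∫⁻ z, (v : ℝ≥0∞) ^ (q / 2) * ‖z‖ₑ ^ q ∂gaussianReal 0 1 := by
        rw [← hmap, lintegral_map hmeas (measurable_const_mul _)]
        refine lintegral_congr fun z => ?_
        rw [enorm_mul, ENNReal.mul_rpow_of_nonneg _ _ hq.le]
        congr 1
        have : ‖(NNReal.sqrt v : ℝ)‖ₑ = (v : ℝ≥0∞) ^ (1 / 2 : ℝ) := by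
          rw [Real.enorm_eq_ofReal (by positivity), ENNReal.ofReal_coe_nnreal,
            NNReal.sqrt_eq_rpow, ENNReal.coe_rpow_of_nonneg _ (by norm_num)]
        rw [this, ← ENNReal.rpow_mul]
        congr 1
        ring
    _ = _ := by
        rw [lintegral_const_mul _ hmeas, hv', mul_comm]
        rfl

variable {X : Type*} [MeasurableSpace X] {ν : Measure X} {q : ℝ}

lemma Lp_coeFn_sum_smul {p : ℝ≥0∞} (φ : ℕ → Lp ℝ p ν) (c : ℕ → ℝ) (s : Finset ℕ) :
    ⇑(∑ n ∈ s, c n • φ n) =ᵐ[ν] fun x => ∑ n ∈ s, c n * φ n x := by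
  induction s using Finset.induction_on with
  | empty =>
    simp only [Finset.sum_empty]
    exact Lp.coeFn_zero ℝ p ν
  | insert i s hi ih =>
    simp_rw [Finset.sum_insert hi]
    filter_upwards [Lp.coeFn_add (c i • φ i) (∑ n ∈ s, c n • φ n), Lp.coeFn_smul (c i) (φ i), ih]
      with x h1 h2 h3
    rw [h1, Pi.add_apply, h2, h3, Pi.smul_apply, smul_eq_mul]

/-- A Gaussian sum in `L^q` is controlled by its square function. -/
lemma IsStdGaussianSeq.eLpNorm_sum_smul_le [SFinite ν] [IsProbabilityMeasure P]
    (hγ : IsStdGaussianSeq P γ)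
    (hq : 2 < q) [Fact (1 ≤ ENNReal.ofReal q)] (φ : ℕ → Lp ℝ (ENNReal.ofReal q) ν)
    (s : Finset ℕ) :
    eLpNorm (fun ω => ∑ n ∈ s, γ n ω • φ n) 2 P ≤
      (gaussianMoment q * ∫⁻ x, (∑ n ∈ s, ‖φ n x‖ₑ ^ 2) ^ (q / 2) ∂ν) ^ (1 / q) := by
  have hq0 : 0 < q := by linarith
  have hq1 : ENNReal.ofReal q ≠ 0 := by simpa using hq0
  have hsm : AEStronglyMeasurable (fun ω => ∑ n ∈ s, γ n ω • φ n) P :=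
    Finset.aestronglyMeasurable_fun_sum s fun n _ =>
      (hγ.law n).aemeasurable.aestronglyMeasurable.smul_const _
  have h2q : (2 : ℝ≥0∞) ≤ ENNReal.ofReal q := by
    rw [← ENNReal.ofReal_ofNat]; exact ENNReal.ofReal_le_ofReal hq.le
  -- P is a probability measure, so L²(Ω) can be raised to L^q(Ω); the two exponents then agree and
  -- the integrals in ω and x can be exchanged.
  refine (eLpNorm_le_eLpNorm_of_exponent_le h2q hsm).trans ?_
  rw [eLpNorm_eq_lintegral_rpow_enorm_toReal hq1 ENNReal.ofReal_ne_top,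
    ENNReal.toReal_ofReal hq0.le]
  refine ENNReal.rpow_le_rpow (le_of_eq ?_) (by positivity)
  have hpt (ω : Ω) : ‖∑ n ∈ s, γ n ω • φ n‖ₑ ^ q =
      ∫⁻ x, ‖∑ n ∈ s, γ n ω * φ n x‖ₑ ^ q ∂ν := by
    rw [Lp.enorm_def, eLpNorm_eq_lintegral_rpow_enorm_toReal hq1 ENNReal.ofReal_ne_top,
      ENNReal.toReal_ofReal hq0.le, ← ENNReal.rpow_mul, one_div_mul_cancel hq0.ne',
      ENNReal.rpow_one]
    refine lintegral_congr_ae ?_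
    filter_upwards [Lp_coeFn_sum_smul φ (fun n => γ n ω) s] with x hx
    rw [hx]
  have hφ (n : ℕ) : Measurable (φ n) := (Lp.stronglyMeasurable (φ n)).measurable
  simp_rw [hpt]
  rw [lintegral_lintegral_swap]
  · simp_rw [hγ.lintegral_enorm_sum_rpow _ s hq0]
    rw [lintegral_const_mul]
    exact (Finset.measurable_fun_sum s fun n _ => (hφ n).enorm.pow_const 2).pow_const _
  · refine AEMeasurable.pow_const (AEMeasurable.enorm ?_) _
    refine Finset.aemeasurable_fun_sum s fun n _ => ?_
    exact (hγ.law n).aemeasurable.comp_fst.mul ((hφ n).comp measurable_snd).aemeasurable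

variable {H : Type*} [NormedAddCommGroup H] [InnerProductSpace ℝ H]

/-- An operator into `L^q` given pointwise by inner products against a family of vectors
has square function at most the norms of these vectors. -/
lemma tsum_enorm_sq_le_of_inner_eq {p : ℝ≥0∞} [Fact (1 ≤ p)] (h : HilbertBasis ℕ ℝ H)
    (T : H →L[ℝ] Lp ℝ p ν) {ψ : X → H} {k : X → ℝ≥0∞}
    (hT : ∀ u, T u =ᵐ[ν] fun x => inner ℝ (ψ x) u) (hk : ∀ᵐ x ∂ν, ‖ψ x‖ₑ ≤ k x) :
    ∀ᵐ x ∂ν, ∑' n, ‖T (h n) x‖ₑ ^ 2 ≤ k x ^ 2 := by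
  filter_upwards [ae_all_iff.2 fun n => hT (h n), hk] with x hx hkx
  refine le_trans ?_ (pow_le_pow_left' hkx 2)
  rw [ENNReal.tsum_eq_iSup_sum]
  refine iSup_le fun s => ?_
  -- Bessel's inequality for ψ x bounds every finite partial sum.
  have := h.orthonormal.sum_inner_products_le (s := s) (ψ x)
  have e : ∑ n ∈ s, ‖T (h n) x‖ₑ ^ 2 = ENNReal.ofReal (∑ n ∈ s, ‖inner ℝ (h n) (ψ x)‖ ^ 2) := by
    rw [ENNReal.ofReal_sum_of_nonneg fun _ _ => by positivity]
    refine Finset.sum_congr rfl fun n _ => ?_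
    rw [hx n, real_inner_comm, ENNReal.ofReal_pow (norm_nonneg _), ofReal_norm]
  rw [e, ← ofReal_norm, ← ENNReal.ofReal_pow (norm_nonneg _)]
  exact ENNReal.ofReal_le_ofReal this

/-- Lower semicontinuity by the triangle inequality: S is a partial sum minus an error tending to 0.
It applies to any sum S, hence to the one chosen in `gammaNorm`. -/
lemma HasGaussianSum.eLpNorm_le {E : Type*} [NormedAddCommGroup E] [NormedSpace ℝ E]
    {h : HilbertBasis ℕ ℝ H} {T : H →L[ℝ] E} {S : Ω → E} (hS : HasGaussianSum P γ h T S)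
    (hγ : IsStdGaussianSeq P γ) {B : ℝ≥0∞}
    (hB : ∀ N : ℕ, eLpNorm (fun ω => ∑ n ∈ Finset.range N, γ n ω • T (h n)) 2 P ≤ B) :
    eLpNorm S 2 P ≤ B := by
  have hlim : Tendsto (fun N : ℕ => B +
      eLpNorm (fun ω => (∑ n ∈ Finset.range N, γ n ω • T (h n)) - S ω) 2 P) atTop (𝓝 (B + 0)) :=
    tendsto_const_nhds.add hS.2
  rw [add_zero] at hlim
  refine ge_of_tendsto' hlim fun N => ?_
  have hsm : AEStronglyMeasurable (fun ω => ∑ n ∈ Finset.range N, γ n ω • T (h n)) P :=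
    Finset.aestronglyMeasurable_fun_sum _ fun n _ =>
      (hγ.law n).aemeasurable.aestronglyMeasurable.smul_const _
  have e : S = (fun ω => ∑ n ∈ Finset.range N, γ n ω • T (h n)) -
      fun ω => (∑ n ∈ Finset.range N, γ n ω • T (h n)) - S ω := by
    ext1 ω; simp
  refine (congrArg (fun F => eLpNorm F 2 P) e).le.trans ?_
  refine (eLpNorm_sub_le hsm (hsm.sub hS.1.1) (by norm_num)).trans ?_
  refine add_le_add (hB N) (le_of_eq (congrArg (fun F => eLpNorm F 2 P) ?_))
  ext1 ω
  simp

/-- The tail of the square function tends to 0 almost everywhere and is dominated by k ∈ L^q, so the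
partial sums are Cauchy in the complete space L²(Ω; L^q). -/
theorem isGammaRadonifying_of_inner_eq [SFinite ν] [IsProbabilityMeasure P]
    (hγ : IsStdGaussianSeq P γ)
    (hq : 2 < q) [Fact (1 ≤ ENNReal.ofReal q)] (h : HilbertBasis ℕ ℝ H)
    (T : H →L[ℝ] Lp ℝ (ENNReal.ofReal q) ν) {ψ : X → H} {k : X → ℝ≥0∞} (hkm : Measurable k)
    (hT : ∀ u, T u =ᵐ[ν] fun x => inner ℝ (ψ x) u) (hk : ∀ᵐ x ∂ν, ‖ψ x‖ₑ ≤ k x)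
    (hkq : ∫⁻ x, k x ^ q ∂ν ≠ ∞) :
    IsGammaRadonifying P γ h T := by
  have hq0 : 0 < q := by linarith
  have hsq := tsum_enorm_sq_le_of_inner_eq h T hT hk
  let φ : ℕ → Lp ℝ (ENNReal.ofReal q) ν := fun n => T (h n)
  have hφ (n : ℕ) : Measurable (φ n) := (Lp.stronglyMeasurable (φ n)).measurable
  let R : ℕ → X → ℝ≥0∞ := fun N x => ∑' n, ‖φ (n + N) x‖ₑ ^ 2
  let b : ℕ → ℝ≥0∞ := fun N => (gaussianMoment q * ∫⁻ x, R N x ^ (q / 2) ∂ν) ^ (1 / q)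
  have hRle (N : ℕ) (x : X) : R N x ≤ ∑' n, ‖φ n x‖ₑ ^ 2 :=
    ENNReal.tsum_comp_le_tsum_of_injective (add_left_injective N) fun n => ‖φ n x‖ₑ ^ 2
  have hksq (x : X) : (k x ^ 2) ^ (q / 2) = k x ^ q := by
    rw [← ENNReal.rpow_natCast, ← ENNReal.rpow_mul]
    congr 1
    push_cast
    ring
  have hRlim : Tendsto (fun N => ∫⁻ x, R N x ^ (q / 2) ∂ν) atTop (𝓝 0) := by
    have := tendsto_lintegral_of_dominated_convergence (μ := ν)
      (F := fun N x => R N x ^ (q / 2)) (f := fun _ => 0) (fun x => k x ^ q)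
      (fun N => (Measurable.tsum fun n => (hφ _).enorm.pow_const 2).pow_const _)
      (fun N => by
        filter_upwards [hsq] with x hx
        rw [← hksq]
        exact ENNReal.rpow_le_rpow ((hRle N x).trans hx) (by positivity))
      hkq
      (by
        filter_upwards [hsq, ae_lt_top (hkm.pow_const q) hkq] with x hx hkx
        have hkx' : k x ≠ ∞ := by
          intro h
          rw [h, ENNReal.top_rpow_of_pos hq0] at hkx
          exact lt_irrefl _ hkx
        have h1 : Tendsto (fun N => R N x) atTop (𝓝 0) :=
          ENNReal.tendsto_sum_nat_add (fun n => ‖φ n x‖ₑ ^ 2)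
            (ne_top_of_le_ne_top (ENNReal.pow_ne_top hkx') hx)
        have h2 := h1.ennrpow_const (q / 2)
        rwa [ENNReal.zero_rpow_of_pos (by positivity)] at h2)
    simpa using this
  have hb : Tendsto b atTop (𝓝 0) := by
    have h1 := ENNReal.Tendsto.const_mul hRlim (Or.inr (gaussianMoment_ne_top hq0))
    have h2 := h1.ennrpow_const (1 / q)
    rwa [mul_zero, ENNReal.zero_rpow_of_pos (by positivity)] at h2
  have hmem (N : ℕ) : MemLp (fun ω => ∑ n ∈ Finset.range N, γ n ω • φ n) 2 P := by
    refine memLp_finsetSum _ fun n _ => ?_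
    have hg : MemLp (γ n) 2 P := by
      have := memLp_id_gaussianReal' (μ := 0) (v := 1) 2 (by norm_num)
      rw [← (hγ.law n).map_eq] at this
      exact this.comp_of_map (hγ.law n).aemeasurable
    refine ⟨hg.1.smul_const _, ?_⟩
    have e : eLpNorm (fun ω => γ n ω • φ n) 2 P ≤ ‖φ n‖ₑ * eLpNorm (γ n) 2 P := by
      refine (eLpNorm_le_nnreal_smul_eLpNorm_of_ae_le_mul (c := ‖φ n‖₊) (ae_of_all _ fun ω => ?_) 2)
      rw [nnnorm_smul, mul_comm]
    exact e.trans_lt (ENNReal.mul_lt_top enorm_lt_top hg.2)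
  -- A block of the series starting at m ≥ N has square function at most the tail R N.
  have hdist {m n N : ℕ} (hN : N ≤ m) (hmn : m ≤ n) :
      edist ((hmem n).toLp) ((hmem m).toLp) ≤ b N := by
    rw [Lp.edist_toLp_toLp]
    have e : ((fun ω => ∑ n ∈ Finset.range n, γ n ω • φ n) -
        fun ω => ∑ n ∈ Finset.range m, γ n ω • φ n) =
        fun ω => ∑ n ∈ Finset.Ico m n, γ n ω • φ n := by
      ext1 ω
      rw [Finset.sum_Ico_eq_sub _ hmn]
      rfl
    rw [e]
    refine (hγ.eLpNorm_sum_smul_le hq φ _).trans ?_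
    refine ENNReal.rpow_le_rpow (mul_le_mul_right (lintegral_mono fun x => ?_) _) (by positivity)
    refine ENNReal.rpow_le_rpow ?_ (by positivity)
    obtain ⟨m, rfl⟩ := Nat.exists_eq_add_of_le' hN
    obtain ⟨n, rfl⟩ := Nat.exists_eq_add_of_le' (hN.trans hmn)
    rw [← Finset.sum_Ico_add' (fun n => ‖φ n x‖ₑ ^ 2) m n N]
    exact ENNReal.sum_le_tsum _
  have hcauchy : CauchySeq fun N => (hmem N).toLp := by
    refine EMetric.cauchySeq_iff_le_tendsto_0.2 ⟨b, fun n m N hn hm => ?_, hb⟩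
    rcases le_total m n with hmn | hmn
    · exact hdist hm hmn
    · rw [edist_comm]; exact hdist hn hmn
  obtain ⟨S, hS⟩ := cauchySeq_tendsto_of_complete hcauchy
  refine ⟨S, Lp.memLp S, ?_⟩
  rw [← Lp.toLp_coeFn S (Lp.memLp S), Lp.tendsto_Lp_iff_tendsto_eLpNorm''] at hS
  exact hS

theorem gammaNorm_le_of_inner_eq [SFinite ν] [IsProbabilityMeasure P]
    (hγ : IsStdGaussianSeq P γ)
    (hq : 2 < q) [Fact (1 ≤ ENNReal.ofReal q)] (h : HilbertBasis ℕ ℝ H)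
    (T : H →L[ℝ] Lp ℝ (ENNReal.ofReal q) ν) {ψ : X → H} {k : X → ℝ≥0∞} (hkm : Measurable k)
    (hT : ∀ u, T u =ᵐ[ν] fun x => inner ℝ (ψ x) u) (hk : ∀ᵐ x ∂ν, ‖ψ x‖ₑ ≤ k x)
    (hkq : ∫⁻ x, k x ^ q ∂ν ≠ ∞) :
    gammaNorm P γ h T ≤ (gaussianMoment q * ∫⁻ x, k x ^ q ∂ν) ^ (1 / q) := by
  have hrad := isGammaRadonifying_of_inner_eq hγ hq h T hkm hT hk hkq
  rw [gammaNorm, dif_pos hrad]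
  refine hrad.choose_spec.eLpNorm_le hγ fun N => ?_
  refine (hγ.eLpNorm_sum_smul_le hq (fun n => T (h n)) _).trans ?_
  refine ENNReal.rpow_le_rpow (mul_le_mul_right (lintegral_mono_ae ?_) _) (by positivity)
  filter_upwards [tsum_enorm_sq_le_of_inner_eq h T hT hk] with x hx
  calc (∑ n ∈ Finset.range N, ‖T (h n) x‖ₑ ^ 2) ^ (q / 2) ≤ (k x ^ 2) ^ (q / 2) :=
        ENNReal.rpow_le_rpow ((ENNReal.sum_le_tsum _).trans hx) (by positivity)
    _ = k x ^ q := by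
        rw [← ENNReal.rpow_natCast, ← ENNReal.rpow_mul]
        congr 1
        push_cast
        ring

/-- Construction of an operator into `L^q` from a family of vectors with norms in `L^q`. -/
theorem exists_clm_of_inner (hq : 2 < q) [Fact (1 ≤ ENNReal.ofReal q)] {ψ : X → H} {k : X → ℝ≥0∞}
    (hψ : ∀ u : H, AEStronglyMeasurable (fun x => inner ℝ (ψ x) u) ν)
    (hk : ∀ᵐ x ∂ν, ‖ψ x‖ₑ ≤ k x) (hkq : ∫⁻ x, k x ^ q ∂ν ≠ ∞) :
    ∃ T : H →L[ℝ] Lp ℝ (ENNReal.ofReal q) ν, ∀ u, T u =ᵐ[ν] fun x => inner ℝ (ψ x) u := by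
  have hq0 : 0 < q := by linarith
  have hq1 : ENNReal.ofReal q ≠ 0 := by simpa using hq0
  set K := (∫⁻ x, k x ^ q ∂ν) ^ (1 / q) with hK_def
  have hK : K ≠ ∞ := ENNReal.rpow_ne_top_of_nonneg (by positivity) hkq
  have hbound (u : H) : eLpNorm (fun x => inner ℝ (ψ x) u) (ENNReal.ofReal q) ν ≤ K * ‖u‖ₑ := by
    rw [eLpNorm_eq_lintegral_rpow_enorm_toReal hq1 ENNReal.ofReal_ne_top,
      ENNReal.toReal_ofReal hq0.le]
    calc (∫⁻ x, ‖inner ℝ (ψ x) u‖ₑ ^ q ∂ν) ^ (1 / q)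
        ≤ (∫⁻ x, k x ^ q * ‖u‖ₑ ^ q ∂ν) ^ (1 / q) := by
          refine ENNReal.rpow_le_rpow (lintegral_mono_ae ?_) (by positivity)
          filter_upwards [hk] with x hx
          rw [← ENNReal.mul_rpow_of_nonneg _ _ hq0.le]
          refine ENNReal.rpow_le_rpow (le_trans ?_ (mul_le_mul_left hx _)) hq0.le
          rw [← ofReal_norm, ← ofReal_norm, ← ofReal_norm, ← ENNReal.ofReal_mul (norm_nonneg _)]
          exact ENNReal.ofReal_le_ofReal (norm_inner_le_norm _ _)
      _ = K * ‖u‖ₑ := by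
          rw [lintegral_mul_const' _ _ (ENNReal.rpow_ne_top_of_nonneg hq0.le enorm_ne_top),
            ENNReal.mul_rpow_of_nonneg _ _ (by positivity), ← ENNReal.rpow_mul ‖u‖ₑ,
            mul_one_div_cancel hq0.ne', ENNReal.rpow_one]
  have hmem (u : H) : MemLp (fun x => inner ℝ (ψ x) u) (ENNReal.ofReal q) ν :=
    ⟨hψ u, (hbound u).trans_lt (ENNReal.mul_lt_top hK.lt_top enorm_lt_top)⟩
  let T₀ : H →ₗ[ℝ] Lp ℝ (ENNReal.ofReal q) ν :=
    { toFun := fun u => (hmem u).toLp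
      map_add' := fun u v => by
        rw [← MemLp.toLp_add]
        exact MemLp.toLp_congr _ _ (ae_of_all _ fun x => inner_add_right _ _ _)
      map_smul' := fun c u => by
        rw [RingHom.id_apply, ← MemLp.toLp_const_smul]
        exact MemLp.toLp_congr _ _ (ae_of_all _ fun x => real_inner_smul_right _ _ _) }
  refine ⟨T₀.mkContinuous K.toReal fun u => ?_, fun u => (hmem u).coeFn_toLp⟩
  change ‖(hmem u).toLp‖ ≤ _
  rw [Lp.norm_toLp, ← toReal_enorm u, ← ENNReal.toReal_mul]
  exact ENNReal.toReal_mono (ENNReal.mul_ne_top hK enorm_ne_top) (hbound u)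

end GaussianSums

/-! ### The kernel f(x - y)g(y) and its L² norm -/

section ConvMul

/-- The level sets of the square of a normalised function in weak `L^r`. -/
lemma measure_lt_div_sq_le {α : Type*} [MeasurableSpace α] {μ : Measure α} {f : α → ℝ} {r : ℝ}
    (hr : 0 < r) {A : ℝ≥0∞} (hA : A ≠ 0) (hA' : A ≠ ∞) (hf : weakLpNorm f r μ ≤ A)
    {t : ℝ≥0∞} (ht : t ≠ 0) (ht' : t ≠ ∞) :
    μ {x | t < (‖f x‖ₑ / A) ^ 2} ≤ t ^ (-(r / 2)) := by
  -- The set where (|f|/A)² exceeds t is the level set of |f| at height A·t^(1/2); this halves the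
  -- weak exponent to r/2.
  set l : ℝ≥0∞ := t ^ (1 / 2 : ℝ) with hl_def
  have hl : l ≠ 0 := (ENNReal.rpow_pos (pos_iff_ne_zero.2 ht) ht').ne'
  have hl' : l ≠ ∞ := ENNReal.rpow_ne_top_of_nonneg (by norm_num) ht'
  have hl2 : t = l ^ 2 := by
    rw [hl_def, ← ENNReal.rpow_natCast, ← ENNReal.rpow_mul]; norm_num
  have hlA : l * A ≠ ∞ := ENNReal.mul_ne_top hl' hA'
  have hset : {x | t < (‖f x‖ₑ / A) ^ 2} = {x | (l * A).toReal < ‖f x‖} := by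
    ext x
    rw [Set.mem_ofPred_eq, Set.mem_ofPred_eq, hl2, ENNReal.pow_lt_pow_left_iff two_ne_zero,
      ENNReal.lt_div_iff_mul_lt (Or.inl hA) (Or.inl hA'), ← toReal_enorm,
      ENNReal.toReal_lt_toReal hlA enorm_ne_top]
  have hpos : 0 < (l * A).toReal := ENNReal.toReal_pos (mul_ne_zero hl hA) hlA
  have h1 : ENNReal.ofReal (l * A).toReal * (μ {x | (l * A).toReal < ‖f x‖}) ^ (1 / r) ≤ A :=
    le_trans (le_iSup₂_of_le (f := fun (t : ℝ) (_ : 0 < t) =>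
      ENNReal.ofReal t * (μ {x | t < ‖f x‖}) ^ (1 / r)) _ hpos le_rfl) hf
  rw [hset]
  set M := μ {x | (l * A).toReal < ‖f x‖}
  rw [ENNReal.ofReal_toReal hlA, mul_right_comm] at h1
  have h2 : l * M ^ (1 / r) ≤ 1 := by
    rw [← ENNReal.mul_le_mul_iff_left hA hA', one_mul]
    exact h1
  have h3 : M ^ (1 / r) ≤ l⁻¹ := by
    rw [ENNReal.le_inv_iff_mul_le, mul_comm]; exact h2
  rw [one_div, ENNReal.rpow_inv_le_iff hr] at h3
  refine h3.trans_eq ?_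
  rw [hl_def, ← ENNReal.rpow_neg, ← ENNReal.rpow_mul]
  congr 1
  ring

variable {G : Type*} [AddCommGroup G] [MeasurableSpace G] {μ : Measure G}

/-- The square function `(|f|² * |g|²)^{1/2}`. -/
def convSq (μ : Measure G) (f g : G → ℝ) (x : G) : ℝ≥0∞ :=
  (∫⁻ y, ‖f (x - y) * g y‖ₑ ^ 2 ∂μ) ^ (1 / 2 : ℝ)

/-- The constant in the weak Young inequality for `|f|² * |g|²`. -/
def convSqConst (η r q : ℝ) : ℝ≥0∞ :=
  (dyadicConst (r / 2) (q / 2 / (q / 2 - 1)) + dyadicConst (r / 2) (η / 2)) ^ (1 / 2 : ℝ)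

lemma measurable_convSq [MeasurableAdd₂ G] [MeasurableNeg G] [SFinite μ] {f g : G → ℝ}
    (hf : Measurable f) (hg : Measurable g) :
    Measurable (convSq μ f g) := by
  refine Measurable.pow_const ?_ _
  have : Measurable fun p : G × G => ‖f (p.1 - p.2) * g p.2‖ₑ ^ 2 :=
    ((hf.comp (measurable_fst.sub measurable_snd)).mul (hg.comp measurable_snd)).enorm.pow_const 2
  exact this.lintegral_prod_right'

lemma lintegral_convSq_rpow_le_aux [MeasurableAdd₂ G] [MeasurableNeg G] [SigmaFinite μ]
    [μ.IsAddLeftInvariant] [μ.IsNegInvariant] {η r q : ℝ} (hη : 2 < η) (hr : 2 < r) (hq : 2 < q)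
    (h : 1 / q + 1 / 2 = 1 / r + 1 / η) {f g : G → ℝ} (hf : Measurable f) (hg : Measurable g)
    {A B : ℝ≥0∞} (hA : A ≠ 0) (hA' : A ≠ ∞) (hB : B ≠ 0) (hB' : B ≠ ∞)
    (hfA : weakLpNorm f r μ ≤ A) (hgB : eLpNorm g (ENNReal.ofReal η) μ ≤ B) :
    (∫⁻ x, convSq μ f g x ^ q ∂μ) ^ (1 / q) ≤ convSqConst η r q * (A * B) := by
  have hAB : A * B ≠ ∞ := ENNReal.mul_ne_top hA' hB'
  have hlevel (t : ℝ≥0∞) : MeasurableSet {x | t < (‖f x‖ₑ / A) ^ 2} :=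
    measurableSet_lt measurable_const ((hf.enorm.div_const A).pow_const 2)
  -- Doubling the relation between η, r and q gives the Young condition for r/2, η/2, q/2.
  -- Translation and reflection invariance of μ give the weak bounds in each variable.
  have key := lintegral_rpow_lintegral_mul_le_of_weak (μ := μ) (ν := μ) (a := r / 2) (b := η / 2)
    (c := q / 2) (Φ := fun x y => (‖f (x - y)‖ₑ / A) ^ 2) (G := fun y => (‖g y‖ₑ / B) ^ 2)
    (by linarith) (by linarith) (by linarith)
    (by rw [one_div_div, one_div_div, one_div_div]; field_simp at h ⊢; linarith)
    (((hf.comp (measurable_fst.sub measurable_snd)).enorm.div_const A).pow_const 2)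
    ((hg.enorm.div_const B).pow_const 2)
    (fun x y => ENNReal.pow_ne_top (ENNReal.div_ne_top enorm_ne_top hA))
    (fun y t ht ht' => by
      refine ((measurePreserving_sub_right μ y).measure_preimage
        (hlevel t).nullMeasurableSet).trans_le ?_
      exact measure_lt_div_sq_le (by linarith) hA hA' hfA ht ht')
    (fun x t ht ht' => by
      refine ((Measure.measurePreserving_sub_left μ x).measure_preimage
        (hlevel t).nullMeasurableSet).trans_le ?_
      exact measure_lt_div_sq_le (by linarith) hA hA' hfA ht ht')
    (by
      have e (y : G) : ((‖g y‖ₑ / B) ^ 2) ^ (η / 2) = (B ^ η)⁻¹ * ‖g y‖ₑ ^ η := by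
        rw [← ENNReal.rpow_natCast, ← ENNReal.rpow_mul, Nat.cast_ofNat,
          mul_div_cancel₀ _ (two_ne_zero' ℝ), ENNReal.div_rpow_of_nonneg _ _ (by linarith),
          div_eq_mul_inv, mul_comm]
      simp_rw [e]
      rw [lintegral_const_mul _ (hg.enorm.pow_const _)]
      rw [eLpNorm_eq_lintegral_rpow_enorm_toReal (by simp; linarith) ENNReal.ofReal_ne_top,
        ENNReal.toReal_ofReal (by linarith), one_div, ENNReal.rpow_inv_le_iff (by linarith)] at hgB
      refine (mul_le_mul_right hgB _).trans ?_
      exact ENNReal.inv_mul_le_one _)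
  have hconv (x : G) : convSq μ f g x ^ q =
      (A * B) ^ q * (∫⁻ y, (‖f (x - y)‖ₑ / A) ^ 2 * (‖g y‖ₑ / B) ^ 2 ∂μ) ^ (q / 2) := by
    have e : ∫⁻ y, ‖f (x - y) * g y‖ₑ ^ 2 ∂μ =
        (A * B) ^ 2 * ∫⁻ y, (‖f (x - y)‖ₑ / A) ^ 2 * (‖g y‖ₑ / B) ^ 2 ∂μ := by
      rw [← lintegral_const_mul' _ _ (ENNReal.pow_ne_top hAB)]
      refine lintegral_congr fun y => ?_
      rw [← mul_pow, ← mul_pow, enorm_mul, mul_mul_mul_comm, ENNReal.mul_div_cancel hA hA',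
        ENNReal.mul_div_cancel hB hB']
    rw [convSq, e, ← ENNReal.rpow_mul, ENNReal.mul_rpow_of_nonneg _ _ (by positivity),
      ← ENNReal.rpow_natCast, ← ENNReal.rpow_mul]
    congr 2 <;> (push_cast; ring)
  simp_rw [hconv]
  rw [lintegral_const_mul' _ _ (ENNReal.rpow_ne_top_of_nonneg (by linarith) hAB),
    ENNReal.mul_rpow_of_nonneg _ _ (by positivity), ← ENNReal.rpow_mul,
    mul_one_div_cancel (by linarith), ENNReal.rpow_one, mul_comm]
  gcongr
  have := ENNReal.rpow_le_rpow key (z := 1 / 2) (by norm_num)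
  rw [← ENNReal.rpow_mul] at this
  rwa [show 1 / (q / 2) * (1 / 2) = 1 / q by field_simp] at this

lemma convSqConst_ne_top {η r q : ℝ} (hη : 2 < η) (hr : 2 < r) (hq : 2 < q)
    (h : 1 / q + 1 / 2 = 1 / r + 1 / η) : convSqConst η r q ≠ ∞ := by
  have e1 : 1 / (r / 2) = 2 * (1 / r) := by field_simp
  have e2 : 1 / (η / 2) = 2 * (1 / η) := by field_simp
  have e3 : 1 / (q / 2 / (q / 2 - 1)) = 1 - 2 * (1 / q) := by
    rw [one_div_div, sub_div, div_self (by linarith)]; field_simp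
  have hη' : 2 * (1 / η) < 1 := by rw [mul_one_div, div_lt_one (by linarith)]; exact hη
  have hq' : 0 < 1 / q := by positivity
  refine ENNReal.rpow_ne_top_of_nonneg (by norm_num) (ENNReal.add_ne_top.2 ⟨?_, ?_⟩)
  · exact dyadicConst_ne_top (by linarith) (by rw [e1, e3]; linarith)
  · exact dyadicConst_ne_top (by linarith) (by rw [e1, e2]; linarith)

/-- The weak Young inequality for the square function `(|f|² * |g|²)^{1/2}`. -/
theorem lintegral_convSq_rpow_le [MeasurableAdd₂ G] [MeasurableNeg G] [SigmaFinite μ]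
    [μ.IsAddLeftInvariant] [μ.IsNegInvariant] {η r q : ℝ} (hη : 2 < η) (hr : 2 < r) (hq : 2 < q)
    (h : 1 / q + 1 / 2 = 1 / r + 1 / η) {f g : G → ℝ} (hf : Measurable f) (hg : Measurable g)
    (hfr : weakLpNorm f r μ ≠ ∞) (hgη : eLpNorm g (ENNReal.ofReal η) μ ≠ ∞) :
    (∫⁻ x, convSq μ f g x ^ q ∂μ) ^ (1 / q) ≤
      convSqConst η r q * (weakLpNorm f r μ * eLpNorm g (ENNReal.ofReal η) μ) := by
  set A := weakLpNorm f r μ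
  set B := eLpNorm g (ENNReal.ofReal η) μ
  -- The normalisation divides by A and B, which may vanish; A + 1/n and B + 1/n are used instead,
  -- and n → ∞.
  have hlim (A : ℝ≥0∞) : Tendsto (fun n : ℕ => A + (n : ℝ≥0∞)⁻¹) atTop (𝓝 A) := by
    simpa using tendsto_const_nhds (x := A).add ENNReal.tendsto_inv_nat_nhds_zero
  have hlim2 : Tendsto (fun n : ℕ => convSqConst η r q * ((A + (n : ℝ≥0∞)⁻¹) * (B + (n : ℝ≥0∞)⁻¹)))
      atTop (𝓝 (convSqConst η r q * (A * B))) :=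
    ENNReal.Tendsto.const_mul (ENNReal.Tendsto.mul (hlim A) (Or.inr hgη) (hlim B) (Or.inr hfr))
      (Or.inr (convSqConst_ne_top hη hr hq h))
  refine ge_of_tendsto hlim2 ?_
  filter_upwards [eventually_gt_atTop 0] with n hn
  have h0 : ((n : ℝ≥0∞)⁻¹) ≠ 0 := ENNReal.inv_ne_zero.2 (ENNReal.natCast_ne_top n)
  have h1 : ((n : ℝ≥0∞)⁻¹) ≠ ∞ := ENNReal.inv_ne_top.2 (by exact_mod_cast hn.ne')
  exact lintegral_convSq_rpow_le_aux hη hr hq h hf hg (by simp [h0])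
    (ENNReal.add_ne_top.2 ⟨hfr, h1⟩) (by simp [h0]) (ENNReal.add_ne_top.2 ⟨hgη, h1⟩)
    le_self_add le_self_add

lemma memLp_two_of_convSq_ne_top [MeasurableAdd₂ G] [MeasurableNeg G] {f g : G → ℝ}
    (hf : Measurable f) (hg : Measurable g) {x : G} (hx : convSq μ f g x ≠ ∞) :
    MemLp (fun y => f (x - y) * g y) 2 μ := by
  refine ⟨((hf.comp (measurable_const.sub measurable_id)).mul hg).aestronglyMeasurable, ?_⟩
  rw [eLpNorm_eq_lintegral_rpow_enorm_toReal two_ne_zero ENNReal.ofNat_ne_top]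
  simpa [convSq, lt_top_iff_ne_top] using hx

open Classical in
/-- The function `y ↦ f (x - y) * g y` as an element of `L²` (and `0` if it is not in `L²`). -/
def convKernel (μ : Measure G) (f g : G → ℝ) (x : G) : Lp ℝ 2 μ :=
  if hx : MemLp (fun y => f (x - y) * g y) 2 μ then hx.toLp else 0

lemma enorm_convKernel_le (f g : G → ℝ) (x : G) : ‖convKernel μ f g x‖ₑ ≤ convSq μ f g x := by
  rw [convKernel]
  split_ifs with hx
  · rw [Lp.enorm_toLp, eLpNorm_eq_lintegral_rpow_enorm_toReal two_ne_zero ENNReal.ofNat_ne_top]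
    simp [convSq]
  · simp

lemma inner_convKernel {f g : G → ℝ} {x : G} (hx : MemLp (fun y => f (x - y) * g y) 2 μ)
    (u : Lp ℝ 2 μ) : inner ℝ (convKernel μ f g x) u = ∫ y, f (x - y) * g y * u y ∂μ := by
  rw [convKernel, dif_pos hx, L2.inner_def]
  refine integral_congr_ae ?_
  filter_upwards [hx.coeFn_toLp] with y hy
  rw [hy]
  simp [mul_comm]

lemma aestronglyMeasurable_integral_conv [MeasurableAdd₂ G] [MeasurableNeg G] [SFinite μ]
    {f g : G → ℝ} (hf : Measurable f) (hg : Measurable g) (u : Lp ℝ 2 μ) :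
    AEStronglyMeasurable (fun x => ∫ y, f (x - y) * g y * u y ∂μ) μ := by
  have hu : Measurable u := (Lp.stronglyMeasurable u).measurable
  have : Measurable fun p : G × G => f (p.1 - p.2) * g p.2 * u p.2 :=
    ((hf.comp (measurable_fst.sub measurable_snd)).mul (hg.comp measurable_snd)).mul
      (hu.comp measurable_snd)
  exact this.stronglyMeasurable.integral_prod_right'.aestronglyMeasurable

end ConvMul

lemma weakLpNorm_congr_ae {α : Type*} [MeasurableSpace α] {μ : Measure α} {f f' : α → ℝ} {p : ℝ}
    (h : f =ᵐ[μ] f') : weakLpNorm f p μ = weakLpNorm f' p μ := by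
  have e (t : ℝ) : μ {x | t < ‖f x‖} = μ {x | t < ‖f' x‖} := by
    refine measure_congr ?_
    filter_upwards [h] with x hx
    exact congrArg (fun z : ℝ => t < ‖z‖) hx
  simp only [weakLpNorm, e]

/-- For every fixed x the map y ↦ x - y pulls null sets back to null sets, so changing f or g on a
null set alters no integral A_{f,g}u(x). -/
lemma IsConvMulOp.congr_ae {d : ℕ} {p : ℝ≥0∞} [Fact (1 ≤ p)]
    {f f' g g' : EuclideanSpace ℝ (Fin d) → ℝ} {T} (hT : IsConvMulOp (p := p) f g T)
    (hf : f =ᵐ[volume] f') (hg : g =ᵐ[volume] g') : IsConvMulOp (p := p) f' g' T := by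
  have hae (u : EuclideanSpace ℝ (Fin d) → ℝ) (x) :
      (fun y => f (x - y) * g y * u y) =ᵐ[volume] fun y => f' (x - y) * g' y * u y := by
    filter_upwards [(quasiMeasurePreserving_sub_left volume x).ae_eq hf, hg] with y h1 h2
    simp only [Function.comp] at h1
    rw [h1, h2]
  intro u
  refine ⟨?_, ?_⟩
  · filter_upwards [(hT u).1] with x hx
    exact hx.congr (hae u x)
  · refine (hT u).2.trans (ae_of_all _ fun x => ?_)
    exact integral_congr_ae (hae u x)

end

/-! ### Assembly of the theorem -/

theorem theoremt (η r q : ℝ) [Fact (1 ≤ ENNReal.ofReal q)]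
    (hη : 2 < η) (hr : 2 < r) (hq : 2 < q) (hηrq : 1 / q + 1 / 2 = 1 / r + 1 / η) :
    ∃ C : ℝ≥0, ∀ (d : ℕ), 1 ≤ d → ∀ (f g : EuclideanSpace ℝ (Fin d) → ℝ),
      MemWeakLp f r volume → MemLp g (ENNReal.ofReal η) volume →
      ∃ T : Lp ℝ 2 (volume : Measure (EuclideanSpace ℝ (Fin d))) →L[ℝ]
          Lp ℝ (ENNReal.ofReal q) (volume : Measure (EuclideanSpace ℝ (Fin d))),
        IsConvMulOp f g T ∧
        ∀ (Ω : Type*) [MeasurableSpace Ω] (P : Measure Ω) [IsProbabilityMeasure P]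
          (γ : ℕ → Ω → ℝ), IsStdGaussianSeq P γ →
          ∀ h : HilbertBasis ℕ ℝ (Lp ℝ 2 (volume : Measure (EuclideanSpace ℝ (Fin d)))),
            IsGammaRadonifying P γ h T ∧
            gammaNorm P γ h T ≤
              C * weakLpNorm f r volume * eLpNorm g (ENNReal.ofReal η) volume := by
  have hq0 : 0 < q := by linarith
  have hC : gaussianMoment q ^ (1 / q) * convSqConst η r q ≠ ∞ :=
    ENNReal.mul_ne_top (ENNReal.rpow_ne_top_of_nonneg (by positivity) (gaussianMoment_ne_top hq0))
      (convSqConst_ne_top hη hr hq hηrq)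
  refine ⟨(gaussianMoment q ^ (1 / q) * convSqConst η r q).toNNReal, fun d _ f g hf hg => ?_⟩
  -- Borel representatives make (x, y) ↦ f₀(x - y)g₀(y) jointly measurable, as Fubini requires.
  obtain ⟨f₀, hf₀, hff₀⟩ : ∃ f₀, Measurable f₀ ∧ f =ᵐ[volume] f₀ :=
    ⟨hf.1.mk f, hf.1.stronglyMeasurable_mk.measurable, hf.1.ae_eq_mk⟩
  obtain ⟨g₀, hg₀, hgg₀⟩ : ∃ g₀, Measurable g₀ ∧ g =ᵐ[volume] g₀ :=
    ⟨hg.1.mk g, hg.1.stronglyMeasurable_mk.measurable, hg.1.ae_eq_mk⟩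
  rw [ENNReal.coe_toNNReal hC, weakLpNorm_congr_ae hff₀, eLpNorm_congr_ae hgg₀]
  have hwf : weakLpNorm f₀ r volume ≠ ∞ := by
    rw [← weakLpNorm_congr_ae hff₀]; exact hf.2.ne
  have hng : eLpNorm g₀ (ENNReal.ofReal η) volume ≠ ∞ := by
    rw [← eLpNorm_congr_ae hgg₀]; exact hg.2.ne
  have hY := lintegral_convSq_rpow_le hη hr hq hηrq hf₀ hg₀ hwf hng
  have hkm : Measurable (convSq volume f₀ g₀) := measurable_convSq hf₀ hg₀
  have hkq : ∫⁻ x, convSq volume f₀ g₀ x ^ q ≠ ∞ := by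
    intro htop
    rw [htop, ENNReal.top_rpow_of_pos (by positivity), top_le_iff] at hY
    exact ENNReal.mul_ne_top (convSqConst_ne_top hη hr hq hηrq) (ENNReal.mul_ne_top hwf hng) hY
  -- Since k^q is integrable, k is finite almost everywhere, so the default value 0 of `convKernel`
  -- matters only on a null set.
  have hmem : ∀ᵐ x, MemLp (fun y => f₀ (x - y) * g₀ y) 2 volume := by
    filter_upwards [ae_lt_top (hkm.pow_const q) hkq] with x hx
    refine memLp_two_of_convSq_ne_top hf₀ hg₀ fun h => ?_
    rw [h, ENNReal.top_rpow_of_pos hq0] at hx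
    exact lt_irrefl _ hx
  have hinner (u : Lp ℝ 2 (volume : Measure (EuclideanSpace ℝ (Fin d)))) :
      (fun x => inner ℝ (convKernel volume f₀ g₀ x) u) =ᵐ[volume] convMulOp f₀ g₀ u := by
    filter_upwards [hmem] with x hx
    exact inner_convKernel hx u
  have hk : ∀ᵐ x, ‖convKernel volume f₀ g₀ x‖ₑ ≤ convSq volume f₀ g₀ x :=
    ae_of_all _ (enorm_convKernel_le f₀ g₀)
  obtain ⟨T, hT⟩ := exists_clm_of_inner hq
    (fun u => (aestronglyMeasurable_integral_conv hf₀ hg₀ u).congr (hinner u).symm) hk hkq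
  refine ⟨T, IsConvMulOp.congr_ae (fun u => ⟨?_, (hT u).trans (hinner u)⟩) hff₀.symm hgg₀.symm,
    fun Ω _ P _ γ hγ h => ⟨isGammaRadonifying_of_inner_eq hγ hq h T hkm hT hk hkq, ?_⟩⟩
  · filter_upwards [hmem] with x hx
    -- Existence of the integral is Cauchy–Schwarz: both factors are in L².
    exact hx.integrable_mul (Lp.memLp u)
  · refine (gammaNorm_le_of_inner_eq hγ hq h T hkm hT hk hkq).trans ?_
    rw [ENNReal.mul_rpow_of_nonneg _ _ (by positivity), mul_assoc, mul_assoc]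
    gcongr
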